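/- Let $N\in\mathbb{N}$, $\gamma\ge 0$, $t_0<T$, let $\theta$ be a fixed parameter, and let $f(h,t,\theta)\in\mathbb{R}^N$ be continuous in $(h,t)\in\mathbb{R}^N\times[t_0,T]$ and differentiable in $h$, with $\partial f/\partial h$ continuous in $(h,t)$. Let $h:[t_0,T]\to\mathbb{R}^N$ solve the heavy ball neural ODE $$h''(t)+\gamma h'(t)=f(h(t),t,\theta),\qquad t\in[t_0,T],$$ with momentum $m=h'$, and let the loss $\mathcal{L}:\mathbb{R}^N\to\mathbb{R}$ be differentiable at $h(T)$. For $t\in[t_0,T]$ and $(x,v)\in\mathbb{R}^N\times\mathbb{R}^N$ let $\mathcal{L}_t(x,v)$ be the loss $\mathcal{L}(\tilde h(T))$ of the solution $\tilde h$ of the same equation on $[t,T]$ with $\tilde h(t)=x$, $\tilde h'(t)=v$. Then for every $t\in[t_0,T]$ such solutions are unique, they exist for all $(x,v)$ near $(h(t),m(t))$, and $\mathcal{L}_t$ is differentiable at $(h(t),m(t))$. Write $\partial\mathcal{L}/\partial h(t)$ and $\partial\mathcal{L}/\partial m(t)$ for the partial derivatives of $\mathcal{L}_t$ at $(h(t),m(t))$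 with respect to $x$ and $v$ (row vectors), and let the adjoint state of the second-order equation be $a(t):=\partial\mathcal{L}/\partial m(t)$. Then $a$ is twice differentiable on $[t_0,T]$ (one-sidedly at the end points) and $$a''(t)-\gamma a'(t)=a(t)\,\frac{\partial f}{\partial h}(h(t),t,\theta),\qquad a(T)=0,\quad a'(T)=-\frac{d\mathcal{L}}{dh}(h(T)),$$ with the same damping parameter $\gamma$; moreover $\partial\mathcal{L}/\partial h(t)=\gamma a(t)-a'(t)$ for all $t\in[t_0,T]$. Consequently $b(\tau):=a(T-\tau)$ satisfies on $[0,T-t_0]$ the heavy ball ODE $$b''(\tau)+\gamma b'(\tau)=b(\tau)\,\frac{\partial f}{\partial h}(h(T-\tau),T-\tau,\theta).$$ -/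

import Mathlib

open Set Filter Topology

/-- `y` solves the second-order equation `y'' + c • y' = F t y` on `s`, and `y'` is its velocity.
Derivatives are taken within `s` (one-sided at the end points of an interval). -/
structure SolvesDampedODE {V : Type*} [NormedAddCommGroup V] [NormedSpace ℝ V]
    (c : ℝ) (F : ℝ → V → V) (s : Set ℝ) (y y' : ℝ → V) : Prop where
  hasDeriv : ∀ t ∈ s, HasDerivWithinAt y (y' t) s t
  hasSecondDeriv : ∀ t ∈ s, ∃ y'' : V, HasDerivWithinAt y' y'' s t ∧ y'' + c • y' t = F t (y t)

/-- `(x, v)` solves `x'' + γ x' = F t x`, `v = x'` on `[t, T]`, starting at time `t` from the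
state `z = (position, momentum)`. -/
structure IsTrajectoryFrom {V : Type*} [NormedAddCommGroup V] [NormedSpace ℝ V]
    (γ : ℝ) (F : ℝ → V → V) (t T : ℝ) (z : V × V) (x v : ℝ → V) : Prop where
  solves : SolvesDampedODE γ F (Icc t T) x v
  position : x t = z.1
  momentum : v t = z.2

open Classical in
/-- The position at time `T` of the trajectory that is in the state `z` at time `t`
(`0` if there is no such trajectory on `[t, T]`). -/
noncomputable def finalPosition {V : Type*} [NormedAddCommGroup V] [NormedSpace ℝ V]
    (γ : ℝ) (F : ℝ → V → V) (t T : ℝ) (z : V × V) : V :=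
  if H : ∃ p : (ℝ → V) × (ℝ → V), IsTrajectoryFrom γ F t T z p.1 p.2 then H.choose.1 T else 0

/-- The loss of the final position, as a function of the state `z` at time `t`. -/
noncomputable def lossFrom {V : Type*} [NormedAddCommGroup V] [NormedSpace ℝ V]
    (γ : ℝ) (F : ℝ → V → V) (L : V → ℝ) (t T : ℝ) (z : V × V) : ℝ :=
  L (finalPosition γ F t T z)

/-- `∂L/∂m(t)` along the trajectory `(h, m)`, the momentum `m = h'` at time `t` being varied and
the position at time `t` being kept; a row vector. -/
noncomputable def momentumAdjoint {V : Type*} [NormedAddCommGroup V] [NormedSpace ℝ V]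
    (γ : ℝ) (F : ℝ → V → V) (L : V → ℝ) (T : ℝ) (h m : ℝ → V) (t : ℝ) : V →L[ℝ] ℝ :=
  fderiv ℝ (fun v : V => lossFrom γ F L t T (h t, v)) (m t)

/-- `∂L/∂h(t)` along the trajectory `(h, m)`, the position at time `t` being varied and the
momentum at time `t` being kept; a row vector. -/
noncomputable def positionAdjoint {V : Type*} [NormedAddCommGroup V] [NormedSpace ℝ V]
    (γ : ℝ) (F : ℝ → V → V) (L : V → ℝ) (T : ℝ) (h m : ℝ → V) (t : ℝ) : V →L[ℝ] ℝ :=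
  fderiv ℝ (fun x : V => lossFrom γ F L t T (x, m t)) (h t)

/-! In phase space the equation is a first-order system `Z' = G t Z`; let `A t` be the derivative of
`G t` along the given trajectory. The linear equation `p' = -p A` has a solution with `p T = (dL,
0)`, and the claim is that `p t` is the derivative of the loss with respect to the state at time
`t`.

No differentiability of the flow is needed. If `Y` is a nearby solution, the linear terms cancel in
the derivative of `p (Y - Z)`, leaving `p` applied to the first-order remainder of `G`. That
remainder is uniformly `o(‖Y - Z‖)`, and Grönwall bounds `‖Y - Z‖` by a multiple of the initial
deviation. So the pairing changes only by a little-o between `t` and `T` (`hasFDerivAt_of_adjoint`).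

With `p = (p_h, p_m)` and `D = ∂f/∂h`, the adjoint equation reads `p_h' = -p_m D`, `p_m' = γ p_m -
p_h`. Eliminating `p_h` gives the second-order equation for `a = p_m`
(`solvesDampedODE_of_adjoint`). Reversing time flips the sign of the damping. -/

open Metric NNReal

/-! ### First-order equations: uniqueness, existence near a solution, linear equations -/

section FirstOrder

variable {E : Type*} [NormedAddCommGroup E] [NormedSpace ℝ E]

/-- The radial retraction of a normed space onto the closed ball of radius `R` about `0`. -/
noncomputable def radialClamp (R : ℝ) (x : E) : E := (R / max R ‖x‖) • x

theorem radialClamp_of_norm_le {R : ℝ} (hR : 0 < R) {x : E} (hx : ‖x‖ ≤ R) :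
    radialClamp R x = x := by
  rw [radialClamp, max_eq_left hx, div_self hR.ne', one_smul]

theorem norm_radialClamp_le {R : ℝ} (hR : 0 < R) (x : E) : ‖radialClamp R x‖ ≤ R := by
  have hm : 0 < max R ‖x‖ := lt_max_of_lt_left hR
  rw [radialClamp, norm_smul, Real.norm_of_nonneg (by positivity), div_mul_eq_mul_div,
    div_le_iff₀ hm]
  exact mul_le_mul_of_nonneg_left (le_max_right _ _) hR.le

/-- Moving the point and changing the scaling factor each cost at most `‖x - y‖`, hence the constant
2 in any norm. -/
theorem lipschitzWith_radialClamp {R : ℝ} (hR : 0 < R) :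
    LipschitzWith 2 (radialClamp R : E → E) := by
  refine LipschitzWith.of_dist_le_mul fun x y => ?_
  have hx : 0 < max R ‖x‖ := lt_max_of_lt_left hR
  have hy : 0 < max R ‖y‖ := lt_max_of_lt_left hR
  have hsplit : radialClamp R x - radialClamp R y
      = (R / max R ‖x‖) • (x - y) + (R / max R ‖x‖ - R / max R ‖y‖) • y := by
    simp only [radialClamp]; module
  have h1 : ‖(R / max R ‖x‖) • (x - y)‖ ≤ ‖x - y‖ := by
    rw [norm_smul, Real.norm_of_nonneg (by positivity)]
    exact mul_le_of_le_one_left (norm_nonneg _) ((div_le_one hx).2 (le_max_left _ _))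
  have h2 : ‖(R / max R ‖x‖ - R / max R ‖y‖) • y‖ ≤ ‖x - y‖ := by
    have hdiff : R / max R ‖x‖ - R / max R ‖y‖
        = (R / max R ‖x‖) * ((max R ‖y‖ - max R ‖x‖) / max R ‖y‖) := by
      field_simp
    have habs : |max R ‖y‖ - max R ‖x‖| ≤ ‖x - y‖ := by
      refine (abs_max_sub_max_le_max R ‖y‖ R ‖x‖).trans ?_
      rw [sub_self, abs_zero, max_eq_right (abs_nonneg _), norm_sub_rev]
      exact abs_norm_sub_norm_le y x
    rw [norm_smul, hdiff, Real.norm_eq_abs, abs_mul, abs_div (_ - _), abs_of_pos hy,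
      abs_of_nonneg (by positivity : 0 ≤ R / max R ‖x‖)]
    calc R / max R ‖x‖ * (|max R ‖y‖ - max R ‖x‖| / max R ‖y‖) * ‖y‖
        = R / max R ‖x‖ * (|max R ‖y‖ - max R ‖x‖| * (‖y‖ / max R ‖y‖)) := by ring
      _ ≤ 1 * (‖x - y‖ * 1) := by
          gcongr
          · exact (div_le_one hx).2 (le_max_left _ _)
          · exact (div_le_one hy).2 (le_max_right _ _)
      _ = ‖x - y‖ := by ring
  rw [dist_eq_norm, dist_eq_norm, hsplit]
  refine (norm_add_le _ _).trans ?_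
  simp only [NNReal.coe_ofNat]
  linarith

/-- `y` solves the first-order equation `y' = G t y` on `[a, b]`. -/
def SolvesODE (G : ℝ → E → E) (a b : ℝ) (y : ℝ → E) : Prop :=
  ∀ t ∈ Icc a b, HasDerivWithinAt y (G t (y t)) (Icc a b) t

namespace SolvesODE

variable {G : ℝ → E → E} {a b : ℝ} {y z : ℝ → E}

theorem continuousOn (hy : SolvesODE G a b y) : ContinuousOn y (Icc a b) :=
  fun t ht => (hy t ht).continuousWithinAt

theorem hasDerivWithinAt_Ici (hy : SolvesODE G a b y) {t : ℝ} (ht : t ∈ Ico a b) :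
    HasDerivWithinAt y (G t (y t)) (Ici t) t :=
  (hy t (Ico_subset_Icc_self ht)).mono_of_mem_nhdsWithin (Icc_mem_nhdsGE_of_mem ht)

theorem mono_left (hy : SolvesODE G a b y) {a' : ℝ} (ha : a ≤ a') : SolvesODE G a' b y :=
  fun t ht => (hy t (Icc_subset_Icc_left ha ht)).mono (Icc_subset_Icc_left ha)

theorem exists_norm_le (hy : SolvesODE G a b y) : ∃ R, 0 < R ∧ ∀ t ∈ Icc a b, ‖y t‖ ≤ R := by
  obtain ⟨R, hR⟩ := isCompact_Icc.exists_bound_of_continuousOn hy.continuousOn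
  exact ⟨max R 1, by positivity, fun t ht => (hR t ht).trans (le_max_left _ _)⟩

/-- Uniqueness for a field that is Lipschitz on balls. -/
theorem eqOn (hlip : ∀ R, ∃ K : ℝ≥0, ∀ t ∈ Icc a b, LipschitzOnWith K (G t) (closedBall 0 R))
    (hy : SolvesODE G a b y) (hz : SolvesODE G a b z) (h : y a = z a) :
    EqOn y z (Icc a b) := by
  obtain ⟨R₁, -, hR₁⟩ := hy.exists_norm_le
  obtain ⟨R₂, -, hR₂⟩ := hz.exists_norm_le
  obtain ⟨K, hK⟩ := hlip (max R₁ R₂)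
  refine ODE_solution_unique_of_mem_Icc_right (s := fun _ => closedBall 0 (max R₁ R₂))
    (fun t ht => hK t (Ico_subset_Icc_self ht)) hy.continuousOn
    (fun t ht => hy.hasDerivWithinAt_Ici ht) (fun t ht => ?_) hz.continuousOn
    (fun t ht => hz.hasDerivWithinAt_Ici ht) (fun t ht => ?_) h
  · exact mem_closedBall_zero_iff.2 ((hR₁ t (Ico_subset_Icc_self ht)).trans (le_max_left _ _))
  · exact mem_closedBall_zero_iff.2 ((hR₂ t (Ico_subset_Icc_self ht)).trans (le_max_right _ _))

end SolvesODE

/-- A bounded, globally Lipschitz field has solutions on the whole interval. -/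
theorem exists_solvesODE_of_bounded [CompleteSpace E] {G : ℝ → E → E} {a b : ℝ} (hab : a ≤ b)
    {K M : ℝ≥0} (hlip : ∀ t ∈ Icc a b, LipschitzWith K (G t))
    (hcont : ∀ x, ContinuousOn (fun t => G t x) (Icc a b))
    (hM : ∀ t ∈ Icc a b, ∀ x, ‖G t x‖ ≤ M) (z : E) :
    ∃ y, y a = z ∧ SolvesODE G a b y := by
  -- A curve of speed at most `M` stays within `M * (b - a)` of its start, so this radius makes the
  -- local theorem global.
  have hP : IsPicardLindelof G (⟨a, left_mem_Icc.2 hab⟩ : Icc a b) z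
      (M * (b - a).toNNReal) 0 M K :=
    { lipschitzOnWith := fun t ht => (hlip t ht).lipschitzOnWith
      continuousOn := fun x _ => hcont x
      norm_le := fun t ht x _ => hM t ht x
      mul_max_le := by simp [hab] }
  exact hP.exists_eq_forall_mem_Icc_hasDerivWithinAt₀

/-- Near a solution on `[a, b]` all initial values admit solutions on `[a, b]`, and these depend
on the initial value in a Lipschitz way. -/
theorem SolvesODE.exists_near [CompleteSpace E] {G : ℝ → E → E} {a b : ℝ} (hab : a ≤ b)
    (hlip : ∀ R, ∃ K : ℝ≥0, ∀ t ∈ Icc a b, LipschitzOnWith K (G t) (closedBall 0 R))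
    (hcont : ∀ x, ContinuousOn (fun t => G t x) (Icc a b))
    {Z : ℝ → E} (hZ : SolvesODE G a b Z) :
    ∃ r > 0, ∃ C > 0, ∀ z, ‖z - Z a‖ ≤ r → ∃ y, y a = z ∧ SolvesODE G a b y ∧
      ∀ t ∈ Icc a b, ‖y t - Z t‖ ≤ C * ‖z - Z a‖ := by
  obtain ⟨R₀, hR₀, hZR⟩ := hZ.exists_norm_le
  set R := R₀ + 1 with hRdef
  have hR : 0 < R := by positivity
  obtain ⟨K, hK⟩ := hlip R
  have hball (x : E) : radialClamp R x ∈ closedBall (0 : E) R :=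
    mem_closedBall_zero_iff.2 (norm_radialClamp_le hR x)
  -- Clamping makes the field bounded and globally Lipschitz without changing it on the ball of
  -- radius `R`, which contains a unit neighbourhood of the curve `Z`.
  set H : ℝ → E → E := fun t x => G t (radialClamp R x) with hH
  have hHlip : ∀ t ∈ Icc a b, LipschitzWith (K * 2) (H t) := fun t ht =>
    lipschitzOnWith_univ.1 ((hK t ht).comp (lipschitzWith_radialClamp hR).lipschitzOnWith
      (fun x _ => hball x))
  have hHeq {t : ℝ} {x : E} (hx : ‖x‖ ≤ R) : H t x = G t x := by
    simp only [hH, radialClamp_of_norm_le hR hx]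
  obtain ⟨M₀, hM₀⟩ := isCompact_Icc.exists_bound_of_continuousOn (hcont 0)
  have hbound : ∀ t ∈ Icc a b, ∀ x, ‖H t x‖ ≤ (M₀ + K * R).toNNReal := by
    intro t ht x
    have h1 := (hK t ht).dist_le_mul _ (hball x) 0 (mem_closedBall_self hR.le)
    rw [dist_eq_norm, dist_zero_right] at h1
    have h2 : ‖H t x‖ ≤ ‖G t (radialClamp R x) - G t 0‖ + ‖G t 0‖ := norm_le_norm_sub_add _ _
    have h3 : (K : ℝ) * ‖radialClamp R x‖ ≤ K * R :=
      mul_le_mul_of_nonneg_left (norm_radialClamp_le hR x) K.2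
    have h4 := hM₀ t ht
    exact (by linarith : ‖H t x‖ ≤ M₀ + K * R).trans (Real.le_coe_toNNReal _)
  have hZH : SolvesODE H a b Z := fun t ht => by
    rw [hHeq ((hZR t ht).trans (by linarith))]; exact hZ t ht
  set C := Real.exp ((K * 2 : ℝ≥0) * (b - a)) with hC
  have hC0 : 0 < C := Real.exp_pos _
  -- With initial deviation at most `C⁻¹`, the solution stays within 1 of `Z`, where the clamp is
  -- inactive.
  refine ⟨C⁻¹, inv_pos.2 hC0, C, hC0, fun z hz => ?_⟩
  obtain ⟨y, hya, hy⟩ := exists_solvesODE_of_bounded hab hHlip (fun x => hcont _) hbound z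
  have hdist : ∀ t ∈ Icc a b, ‖y t - Z t‖ ≤ C * ‖z - Z a‖ := by
    intro t ht
    have := dist_le_of_trajectories_ODE_of_mem (s := fun _ => univ)
      (fun t ht => (hHlip t (Ico_subset_Icc_self ht)).lipschitzOnWith) hy.continuousOn
      (fun t ht => hy.hasDerivWithinAt_Ici ht) (fun _ _ => trivial) hZH.continuousOn
      (fun t ht => hZH.hasDerivWithinAt_Ici ht) (fun _ _ => trivial) le_rfl t ht
    rw [dist_eq_norm, dist_eq_norm, hya, mul_comm] at this
    refine this.trans (mul_le_mul_of_nonneg_right ?_ (norm_nonneg _))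
    exact Real.exp_le_exp.2 (mul_le_mul_of_nonneg_left (by linarith [ht.2]) (NNReal.coe_nonneg _))
  refine ⟨y, hya, fun t ht => ?_, hdist⟩
  rw [← hHeq]
  · exact hy t ht
  · have h1 : C * ‖z - Z a‖ ≤ 1 := by
      calc C * ‖z - Z a‖ ≤ C * C⁻¹ := mul_le_mul_of_nonneg_left hz hC0.le
        _ = 1 := mul_inv_cancel₀ hC0.ne'
    have h2 := hdist t ht
    have h3 := hZR t ht
    have h4 : ‖y t‖ ≤ ‖y t - Z t‖ + ‖Z t‖ := norm_le_norm_sub_add _ _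
    linarith

/-- Linear equations have solutions on the whole interval. -/
theorem exists_solvesODE_linear [CompleteSpace E] {B : ℝ → E →L[ℝ] E} {a b : ℝ} (hab : a ≤ b)
    (hB : ContinuousOn B (Icc a b)) (z : E) :
    ∃ y, y a = z ∧ SolvesODE (fun t x => B t x) a b y := by
  obtain ⟨K, hK⟩ := isCompact_Icc.exists_bound_of_continuousOn hB
  have hzero : SolvesODE (fun t x => B t x) a b (fun _ => 0) := fun t _ => by
    simpa using hasDerivWithinAt_const t (Icc a b) (0 : E)
  -- Initial values near that of the zero solution suffice: by linearity, `z` is scaled down into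
  -- this neighbourhood and the solution scaled back.
  obtain ⟨r, hr, _, _, hnear⟩ := hzero.exists_near hab
    (fun R => ⟨K.toNNReal, fun t ht => ((B t).lipschitz.weaken
      (NNReal.le_toNNReal_of_coe_le (hK t ht))).lipschitzOnWith⟩)
    (fun x => hB.clm_apply continuousOn_const)
  set c : ℝ := r / (‖z‖ + 1) with hc
  have hc0 : 0 < c := by positivity
  obtain ⟨y, hya, hy, -⟩ := hnear (c • z) (by
    rw [sub_zero, norm_smul, Real.norm_of_nonneg hc0.le, hc, div_mul_eq_mul_div,
      div_le_iff₀ (by positivity)]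
    exact mul_le_mul_of_nonneg_left (by linarith) hr.le)
  refine ⟨fun t => c⁻¹ • y t, ?_, fun t ht => ?_⟩
  · simp only [hya, smul_smul, inv_mul_cancel₀ hc0.ne', one_smul]
  · simpa only [map_smul] using (hy t ht).fun_const_smul c⁻¹

/-- Reversal of time. -/
theorem HasDerivWithinAt.comp_sub_Icc {F : Type*} [NormedAddCommGroup F] [NormedSpace ℝ F]
    {y : ℝ → F} {y' : F} {a b c t : ℝ}
    (h : HasDerivWithinAt y y' (Icc (c - b) (c - a)) (c - t)) :
    HasDerivWithinAt (fun s => y (c - s)) (-y') (Icc a b) t := by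
  have h2 : HasDerivWithinAt (fun s => c - s) (-1) (Icc a b) t :=
    ((hasDerivAt_id t).const_sub c).hasDerivWithinAt
  have := h.scomp t h2 (fun s hs => ⟨by linarith [hs.2], by linarith [hs.1]⟩)
  simpa [Function.comp_def] using this

/-- Solvability of the adjoint linear equation `p' = -p A` with prescribed final value. -/
theorem exists_adjoint {A : ℝ → E →L[ℝ] E} {a b : ℝ} (hab : a ≤ b)
    (hA : ContinuousOn A (Icc a b)) (q : E →L[ℝ] ℝ) :
    ∃ p : ℝ → E →L[ℝ] ℝ, p b = q ∧
      ∀ t ∈ Icc a b, HasDerivWithinAt p (-(p t).comp (A t)) (Icc a b) t := by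
  have hmaps : MapsTo (fun t => b - t) (Icc 0 (b - a)) (Icc a b) :=
    fun s hs => ⟨by linarith [hs.2], by linarith [hs.1]⟩
  have hcont : ContinuousOn (fun t => ((ContinuousLinearMap.compL ℝ E E ℝ).flip (A (b - t))))
      (Icc 0 (b - a)) :=
    (ContinuousLinearMap.continuous _).comp_continuousOn
      (hA.comp (by fun_prop) hmaps)
  obtain ⟨y, hy0, hy⟩ := exists_solvesODE_linear (sub_nonneg.2 hab) hcont q
  refine ⟨fun t => y (b - t), by simpa using hy0, fun t ht => ?_⟩
  have h := hy (b - t) ⟨by linarith [ht.2], by linarith [ht.1]⟩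
  have h' : HasDerivWithinAt y ((y (b - t)).comp (A t)) (Icc (b - b) (b - a)) (b - t) := by
    simpa using h
  exact h'.comp_sub_Icc

end FirstOrder

/-! ### Differentiating the loss by pairing with the adjoint state -/

section Adjoint

variable {E : Type*} [NormedAddCommGroup E] [NormedSpace ℝ E]

/-- A field with continuous spatial derivative is Lipschitz on balls, uniformly in time. -/
theorem exists_lipschitzOnWith_closedBall [ProperSpace E] {G : ℝ → E → E} {A : ℝ → E → E →L[ℝ] E}
    {a b : ℝ} (hG : ∀ t ∈ Icc a b, ∀ x, HasFDerivAt (G t) (A t x) x)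
    (hA : ContinuousOn (fun p : ℝ × E => A p.1 p.2) (Icc a b ×ˢ univ)) (R : ℝ) :
    ∃ K : ℝ≥0, ∀ t ∈ Icc a b, LipschitzOnWith K (G t) (closedBall 0 R) := by
  obtain ⟨K, hK⟩ := (isCompact_Icc.prod (isCompact_closedBall (0 : E) R)).exists_bound_of_continuousOn
    (hA.mono (prod_mono_right (subset_univ _)))
  refine ⟨K.toNNReal, fun t ht => (convex_closedBall (0 : E) R).lipschitzOnWith_of_nnnorm_hasFDerivWithin_le
    (fun x _ => (hG t ht x).hasFDerivWithinAt)
    (fun x hx => NNReal.le_toNNReal_of_coe_le (hK (t, x) ⟨ht, hx⟩))⟩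

/-- The first-order remainder of the field along a curve is small uniformly in time. -/
theorem exists_uniform_remainder_le [ProperSpace E] {G : ℝ → E → E} {A : ℝ → E → E →L[ℝ] E}
    {a b : ℝ} (hG : ∀ t ∈ Icc a b, ∀ x, HasFDerivAt (G t) (A t x) x)
    (hA : ContinuousOn (fun p : ℝ × E => A p.1 p.2) (Icc a b ×ˢ univ)) {Z : ℝ → E} {R : ℝ}
    (hZ : ∀ t ∈ Icc a b, ‖Z t‖ ≤ R) {ε : ℝ} (hε : 0 < ε) :
    ∃ η > 0, ∀ t ∈ Icc a b, ∀ x, ‖x - Z t‖ ≤ η →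
      ‖G t x - G t (Z t) - A t (Z t) (x - Z t)‖ ≤ ε * ‖x - Z t‖ := by
  have huc := (isCompact_Icc.prod (isCompact_closedBall (0 : E) (R + 1))).uniformContinuousOn_of_continuous
    (hA.mono (prod_mono_right (subset_univ _)))
  obtain ⟨δ, hδ, hA'⟩ := Metric.uniformContinuousOn_iff.1 huc ε hε
  -- The bound 1 keeps the ball inside radius `R + 1`, where `A` is uniformly continuous; `δ / 2`
  -- turns `≤` into the strict inequality needed.
  refine ⟨min (δ / 2) 1, by positivity, fun t ht x hx => ?_⟩
  refine (convex_closedBall (Z t) (min (δ / 2) 1)).norm_image_sub_le_of_norm_hasFDerivWithin_le'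
    (fun y _ => (hG t ht y).hasFDerivWithinAt) (fun y hy => ?_)
    (mem_closedBall_self (by positivity)) (mem_closedBall_iff_norm.2 hx)
  have hy1 : ‖y - Z t‖ ≤ δ / 2 := (mem_closedBall_iff_norm.1 hy).trans (min_le_left _ _)
  have hy2 : ‖y - Z t‖ ≤ 1 := (mem_closedBall_iff_norm.1 hy).trans (min_le_right _ _)
  have hy3 : ‖y‖ ≤ ‖y - Z t‖ + ‖Z t‖ := norm_le_norm_sub_add _ _
  have hZt := hZ t ht
  have := hA' (t, y) ⟨ht, mem_closedBall_zero_iff.2 (by linarith)⟩ (t, Z t)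
    ⟨ht, mem_closedBall_zero_iff.2 (by linarith)⟩ (by
      rw [Prod.dist_eq, dist_self, max_eq_right dist_nonneg, dist_eq_norm]; linarith)
  rw [dist_eq_norm] at this
  exact this.le

/-- The derivative of the loss with respect to the initial value is the initial value of the
adjoint state. -/
theorem hasFDerivAt_of_adjoint [ProperSpace E] [CompleteSpace E] {G : ℝ → E → E}
    {A : ℝ → E → E →L[ℝ] E} {a b : ℝ} (hab : a ≤ b)
    (hcont : ∀ x, ContinuousOn (fun t => G t x) (Icc a b))
    (hG : ∀ t ∈ Icc a b, ∀ x, HasFDerivAt (G t) (A t x) x)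
    (hA : ContinuousOn (fun p : ℝ × E => A p.1 p.2) (Icc a b ×ˢ univ))
    {Z : ℝ → E} (hZ : SolvesODE G a b Z) {p : ℝ → E →L[ℝ] ℝ}
    (hp : ∀ t ∈ Icc a b, HasDerivWithinAt p (-(p t).comp (A t (Z t))) (Icc a b) t)
    {φ Ψ : E → ℝ} (hφ : HasFDerivAt φ (p b) (Z b))
    (hΨ : ∀ y, SolvesODE G a b y → Ψ (y a) = φ (y b)) :
    HasFDerivAt Ψ (p a) (Z a) := by
  obtain ⟨r, hr, C, hC, hnear⟩ :=
    hZ.exists_near hab (exists_lipschitzOnWith_closedBall hG hA) hcont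
  obtain ⟨R, -, hR⟩ := hZ.exists_norm_le
  have hpc : ContinuousOn p (Icc a b) := fun t ht => (hp t ht).continuousWithinAt
  obtain ⟨P, hP⟩ := isCompact_Icc.exists_bound_of_continuousOn hpc
  have hP0 : 0 ≤ P := (norm_nonneg _).trans (hP a (left_mem_Icc.2 hab))
  choose! Y hYa hY hYdist using hnear
  have hr' : ∀ᶠ z in 𝓝 (Z a), ‖z - Z a‖ ≤ r := by
    filter_upwards [closedBall_mem_nhds (Z a) hr] with z hz using mem_closedBall_iff_norm.1 hz
  have hflow : (fun z => Y z b - Z b) =O[𝓝 (Z a)] fun z => z - Z a := by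
    refine Asymptotics.IsBigO.of_bound C ?_
    filter_upwards [hr'] with z hz using hYdist z hz b (right_mem_Icc.2 hab)
  have htend : Tendsto (fun z => Y z b) (𝓝 (Z a)) (𝓝 (Z b)) := by
    have h0 : Tendsto (fun z => z - Z a) (𝓝 (Z a)) (𝓝 0) := by
      have : Continuous fun z => z - Z a := by fun_prop
      simpa using this.tendsto (Z a)
    exact tendsto_sub_nhds_zero_iff.1 (hflow.trans_tendsto h0)
  have hfinal : (fun z => φ (Y z b) - φ (Z b) - p b (Y z b - Z b)) =o[𝓝 (Z a)]
      fun z => z - Z a :=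
    ((hasFDerivAt_iff_isLittleO.1 hφ).comp_tendsto htend).trans_isBigO hflow
  have hdual : (fun z => p b (Y z b - Z b) - p a (z - Z a)) =o[𝓝 (Z a)] fun z => z - Z a := by
    refine Asymptotics.isLittleO_iff.2 fun c hc => ?_
    -- `P * C * (b - a)` is the factor accumulated by integrating the remainder; adding 1 keeps the
    -- divisor positive.
    set D : ℝ := P * C * (b - a) + 1 with hD
    have hba : 0 ≤ b - a := sub_nonneg.2 hab
    have hD0 : 0 < D := by positivity
    obtain ⟨η, hη, hrem⟩ := exists_uniform_remainder_le hG hA hR (div_pos hc hD0)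
    filter_upwards [hr', closedBall_mem_nhds (Z a) (div_pos hη hC)] with z hz hz'
    have hz' : C * ‖z - Z a‖ ≤ η := by
      rw [mul_comm, ← le_div_iff₀ hC]; exact mem_closedBall_iff_norm.1 hz'
    have hder : ∀ t ∈ Icc a b, HasDerivWithinAt (fun t => p t (Y z t - Z t))
        (p t (G t (Y z t) - G t (Z t) - A t (Z t) (Y z t - Z t))) (Icc a b) t := by
      intro t ht
      have := (hp t ht).clm_apply ((hY z hz t ht).sub (hZ t ht))
      refine this.congr_deriv ?_
      simp only [map_sub, neg_apply, ContinuousLinearMap.comp_apply, Pi.sub_apply]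
      ring
    have hbd : ∀ t ∈ Ico a b, ‖p t (G t (Y z t) - G t (Z t) - A t (Z t) (Y z t - Z t))‖
        ≤ P * (c / D * (C * ‖z - Z a‖)) := by
      intro t ht
      have ht' := Ico_subset_Icc_self ht
      have h1 := hYdist z hz t ht'
      refine ((p t).le_opNorm _).trans (mul_le_mul (hP t ht') ?_ (norm_nonneg _) hP0)
      exact (hrem t ht' _ (h1.trans hz')).trans
        (mul_le_mul_of_nonneg_left h1 (div_pos hc hD0).le)
    have := norm_image_sub_le_of_norm_deriv_le_segment' hder hbd b (right_mem_Icc.2 hab)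
    simp only [hYa z hz] at this
    refine this.trans ?_
    have hfrac : P * C * (b - a) / D ≤ 1 := (div_le_one hD0).2 (by linarith)
    calc P * (c / D * (C * ‖z - Z a‖)) * (b - a)
        = P * C * (b - a) / D * (c * ‖z - Z a‖) := by ring
      _ ≤ 1 * (c * ‖z - Z a‖) := by gcongr
      _ = c * ‖z - Z a‖ := one_mul _
  refine hasFDerivAt_iff_isLittleO.2 ((hfinal.add hdual).congr' ?_ EventuallyEq.rfl)
  filter_upwards [hr'] with z hz
  have h1 := hΨ _ (hY z hz)
  rw [hYa z hz] at h1
  rw [h1, hΨ Z hZ]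
  ring

end Adjoint

/-! ### Phase space and the second-order equation -/

section SecondOrder

variable {V : Type*} [NormedAddCommGroup V] [NormedSpace ℝ V]

/-- The first-order field on phase space of `x'' + γ x' = F t x`. -/
def phaseField (γ : ℝ) (F : ℝ → V → V) (t : ℝ) (z : V × V) : V × V :=
  (z.2, F t z.1 - γ • z.2)

/-- The derivative of `phaseField` when `D` is the derivative of `F t` at the position. -/
noncomputable def phaseDeriv (γ : ℝ) (D : V →L[ℝ] V) : V × V →L[ℝ] V × V :=
  (ContinuousLinearMap.snd ℝ V V).prod
    (D.comp (ContinuousLinearMap.fst ℝ V V) - γ • ContinuousLinearMap.snd ℝ V V)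

theorem hasFDerivAt_phaseField {γ : ℝ} {F : ℝ → V → V} {t : ℝ} {z : V × V} {D : V →L[ℝ] V}
    (h : HasFDerivAt (F t) D z.1) :
    HasFDerivAt (phaseField γ F t) (phaseDeriv γ D) z :=
  hasFDerivAt_snd.prodMk ((h.comp z hasFDerivAt_fst).sub (hasFDerivAt_snd.const_smul γ))

theorem continuous_phaseDeriv (γ : ℝ) :
    Continuous (phaseDeriv γ : (V →L[ℝ] V) → (V × V →L[ℝ] V × V)) := by
  have h : (phaseDeriv γ : (V →L[ℝ] V) → (V × V →L[ℝ] V × V)) = fun D =>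
      (ContinuousLinearMap.inl ℝ V V).comp (ContinuousLinearMap.snd ℝ V V)
        + (ContinuousLinearMap.inr ℝ V V).comp
          (D.comp (ContinuousLinearMap.fst ℝ V V) - γ • ContinuousLinearMap.snd ℝ V V) := by
    funext D
    ext <;> simp [phaseDeriv]
  rw [h]
  fun_prop

theorem SolvesDampedODE.solvesODE {γ : ℝ} {F : ℝ → V → V} {a b : ℝ} {x v : ℝ → V}
    (h : SolvesDampedODE γ F (Icc a b) x v) :
    SolvesODE (phaseField γ F) a b fun t => (x t, v t) := by
  intro t ht
  obtain ⟨w, hw, hwF⟩ := h.hasSecondDeriv t ht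
  have := (h.hasDeriv t ht).prodMk hw
  rwa [eq_sub_of_add_eq hwF] at this

theorem SolvesODE.solvesDampedODE {γ : ℝ} {F : ℝ → V → V} {a b : ℝ} {y : ℝ → V × V}
    (h : SolvesODE (phaseField γ F) a b y) :
    SolvesDampedODE γ F (Icc a b) (fun t => (y t).1) fun t => (y t).2 where
  hasDeriv t ht := (h t ht).fst
  hasSecondDeriv t ht := ⟨_, (h t ht).snd, sub_add_cancel _ _⟩

/-- By uniqueness, the trajectory picked by choice in `finalPosition` ends where `y` does. -/
theorem lossFrom_eq {γ : ℝ} {F : ℝ → V → V} {L : V → ℝ} {t T : ℝ} (ht : t ≤ T)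
    (hlip : ∀ R, ∃ K : ℝ≥0, ∀ s ∈ Icc t T,
      LipschitzOnWith K (phaseField γ F s) (closedBall 0 R))
    {y : ℝ → V × V} (hy : SolvesODE (phaseField γ F) t T y) :
    lossFrom γ F L t T (y t) = L (y T).1 := by
  have H : ∃ p : (ℝ → V) × (ℝ → V), IsTrajectoryFrom γ F t T (y t) p.1 p.2 :=
    ⟨(fun s => (y s).1, fun s => (y s).2), hy.solvesDampedODE, rfl, rfl⟩
  have hc := H.choose_spec
  have heq := hc.solves.solvesODE.eqOn hlip hy (Prod.ext hc.position hc.momentum)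
    (right_mem_Icc.2 ht)
  rw [lossFrom, finalPosition, dif_pos H, ← heq]

/-- Time reversal turns the damping of a second-order equation around. -/
theorem SolvesDampedODE.comp_const_sub {c : ℝ} {F : ℝ → V → V} {a b : ℝ} {y y' : ℝ → V}
    (h : SolvesDampedODE (-c) F (Icc a b) y y') :
    SolvesDampedODE c (fun t => F (b - t)) (Icc 0 (b - a)) (fun t => y (b - t))
      fun t => -y' (b - t) := by
  have hIcc : Icc a b = Icc (b - (b - a)) (b - 0) := by simp
  have hmem {t : ℝ} (ht : t ∈ Icc 0 (b - a)) : b - t ∈ Icc a b :=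
    ⟨by linarith [ht.2], by linarith [ht.1]⟩
  refine ⟨fun t ht => ?_, fun t ht => ?_⟩
  · have := h.hasDeriv _ (hmem ht)
    rw [hIcc] at this
    exact this.comp_sub_Icc
  · obtain ⟨w, hw, hwF⟩ := h.hasSecondDeriv _ (hmem ht)
    rw [hIcc] at hw
    refine ⟨w, by simpa only [neg_neg] using hw.comp_sub_Icc.fun_neg, ?_⟩
    rw [← hwF]
    simp

/-- The two components of an adjoint state on phase space. -/
theorem solvesDampedODE_of_adjoint {γ : ℝ} {D : ℝ → V →L[ℝ] V} {a b : ℝ}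
    {p : ℝ → V × V →L[ℝ] ℝ}
    (hp : ∀ t ∈ Icc a b, HasDerivWithinAt p (-(p t).comp (phaseDeriv γ (D t))) (Icc a b) t) :
    SolvesDampedODE (-γ) (fun t α => α.comp (D t)) (Icc a b)
      (fun t => (p t).comp (ContinuousLinearMap.inr ℝ V V))
      fun t => γ • (p t).comp (ContinuousLinearMap.inr ℝ V V)
        - (p t).comp (ContinuousLinearMap.inl ℝ V V) := by
  have hcomp (i : V →L[ℝ] V × V) : ∀ t ∈ Icc a b, HasDerivWithinAt (fun t => (p t).comp i)
      ((-(p t).comp (phaseDeriv γ (D t))).comp i) (Icc a b) t := fun t ht => by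
    have := (hp t ht).clm_comp (hasDerivWithinAt_const t (Icc a b) i)
    simpa using this
  have hinr : ∀ t ∈ Icc a b, HasDerivWithinAt
      (fun t => (p t).comp (ContinuousLinearMap.inr ℝ V V))
      (γ • (p t).comp (ContinuousLinearMap.inr ℝ V V)
        - (p t).comp (ContinuousLinearMap.inl ℝ V V)) (Icc a b) t := fun t ht => by
    refine (hcomp _ t ht).congr_deriv ?_
    ext w
    -- This is the image of `(0, w)` under `phaseDeriv`, split so that linearity of `p t` separates
    -- the two components.
    have : ((w, -(γ • w)) : V × V) = (w, 0) - γ • (0, w) := by simp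
    simp [phaseDeriv, this, -Prod.mk_sub_mk, -Prod.smul_mk]
  refine ⟨hinr, fun t ht => ⟨_, ((hinr t ht).const_smul γ).sub (hcomp _ t ht), ?_⟩⟩
  ext w
  simp [phaseDeriv]

end SecondOrder

theorem proposition1 {N : ℕ} {Θ : Type*} (γ : ℝ) (hγ : 0 ≤ γ) (t₀ T : ℝ) (hT : t₀ < T)
    (f : EuclideanSpace ℝ (Fin N) → ℝ → Θ → EuclideanSpace ℝ (Fin N)) (θ : Θ)
    -- `f(·, ·, θ)` is continuous, and continuously differentiable in the position
    (hf : ContinuousOn (fun p : EuclideanSpace ℝ (Fin N) × ℝ => f p.1 p.2 θ)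
      (univ ×ˢ Icc t₀ T))
    (hfd : ∀ t ∈ Icc t₀ T, Differentiable ℝ (fun y => f y t θ))
    (hfc : ContinuousOn
      (fun p : EuclideanSpace ℝ (Fin N) × ℝ => fderiv ℝ (fun y => f y p.2 θ) p.1)
      (univ ×ˢ Icc t₀ T))
    -- `h` solves `h'' + γ h' = f(h, t, θ)` on `[t₀, T]`, with momentum `m = h'`
    (h m : ℝ → EuclideanSpace ℝ (Fin N))
    (hsol : SolvesDampedODE γ (fun t y => f y t θ) (Icc t₀ T) h m)
    (L : EuclideanSpace ℝ (Fin N) → ℝ) (hL : DifferentiableAt ℝ L (h T)) :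
    -- the loss is a well-defined function of the state at time `t`, near the state of `h`,
    -- and differentiable there
    (∀ t ∈ Icc t₀ T,
      (∀ᶠ z in 𝓝 (h t, m t), ∃ x v, IsTrajectoryFrom γ (fun s y => f y s θ) t T z x v) ∧
      (∀ z x₁ v₁ x₂ v₂, IsTrajectoryFrom γ (fun s y => f y s θ) t T z x₁ v₁ →
        IsTrajectoryFrom γ (fun s y => f y s θ) t T z x₂ v₂ →
        EqOn x₁ x₂ (Icc t T) ∧ EqOn v₁ v₂ (Icc t T)) ∧
      DifferentiableAt ℝ (lossFrom γ (fun s y => f y s θ) L t T) (h t, m t)) ∧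
    ∃ a a' : ℝ → EuclideanSpace ℝ (Fin N) →L[ℝ] ℝ,
      (∀ t ∈ Icc t₀ T, a t = momentumAdjoint γ (fun s y => f y s θ) L T h m t) ∧
      -- `a'' - γ a' = a ∂f/∂h(h(t), t, θ)`
      SolvesDampedODE (-γ) (fun t α => α.comp (fderiv ℝ (fun y => f y t θ) (h t)))
        (Icc t₀ T) a a' ∧
      -- the values at the final time
      a T = 0 ∧ a' T = -fderiv ℝ L (h T) ∧
      -- the relation with the derivative with respect to the position
      (∀ t ∈ Icc t₀ T,
        positionAdjoint γ (fun s y => f y s θ) L T h m t = γ • a t - a' t) ∧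
      -- `b(τ) = a(T - τ)` satisfies `b'' + γ b' = b ∂f/∂h(h(T - τ), T - τ, θ)`
      SolvesDampedODE γ
        (fun τ β => β.comp (fderiv ℝ (fun y => f y (T - τ) θ) (h (T - τ))))
        (Icc 0 (T - t₀)) (fun τ => a (T - τ)) (fun τ => -a' (T - τ)) := by
  let V := EuclideanSpace ℝ (Fin N)
  let F : ℝ → V → V := fun s y => f y s θ
  let A : ℝ → V × V → V × V →L[ℝ] V × V := fun t z => phaseDeriv γ (fderiv ℝ (F t) z.1)
  have hZ : SolvesODE (phaseField γ F) t₀ T fun t => (h t, m t) := hsol.solvesODE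
  have hcont (z : V × V) : ContinuousOn (fun t => phaseField γ F t z) (Icc t₀ T) :=
    continuousOn_const.prodMk
      ((hf.comp (continuousOn_const (c := z.1).prodMk continuousOn_id)
        fun t ht => ⟨trivial, ht⟩).sub continuousOn_const)
  have hG : ∀ t ∈ Icc t₀ T, ∀ z, HasFDerivAt (phaseField γ F t) (A t z) z := fun t ht z =>
    hasFDerivAt_phaseField (hfd t ht z.1).hasFDerivAt
  have hA : ContinuousOn (fun p : ℝ × (V × V) => A p.1 p.2) (Icc t₀ T ×ˢ univ) :=
    (continuous_phaseDeriv γ).comp_continuousOn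
      (hfc.comp (f := fun p : ℝ × (V × V) => (p.2.1, p.1)) (by fun_prop)
        fun p hp => ⟨trivial, hp.1⟩)
  have hsub {t : ℝ} (ht : t ∈ Icc t₀ T) : Icc t T ⊆ Icc t₀ T := Icc_subset_Icc_left ht.1
  have hlip {t : ℝ} (ht : t ∈ Icc t₀ T) (R : ℝ) : ∃ K : ℝ≥0, ∀ s ∈ Icc t T,
      LipschitzOnWith K (phaseField γ F s) (closedBall 0 R) := by
    obtain ⟨K, hK⟩ := exists_lipschitzOnWith_closedBall hG hA R
    exact ⟨K, fun s hs => hK s (hsub ht hs)⟩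
  -- The final loss ignores the momentum, so the final covector has no momentum component; this is
  -- what gives `a T = 0`.
  obtain ⟨p, hpT, hp⟩ := exists_adjoint hT.le
    (hA.comp (continuousOn_id.prodMk hZ.continuousOn) fun t ht => ⟨ht, trivial⟩)
    ((fderiv ℝ L (h T)).comp (ContinuousLinearMap.fst ℝ V V))
  have hloss {t : ℝ} (ht : t ∈ Icc t₀ T) :
      HasFDerivAt (lossFrom γ F L t T) (p t) (h t, m t) := by
    refine hasFDerivAt_of_adjoint (φ := fun z => L z.1) ht.2 (fun z => (hcont z).mono (hsub ht))
      (fun s hs => hG s (hsub ht hs)) (hA.mono (prod_mono_left (hsub ht)))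
      (hZ.mono_left ht.1) (fun s hs => (hp s (hsub ht hs)).mono (hsub ht)) ?_
      (fun y hy => lossFrom_eq ht.2 (hlip ht) hy)
    rw [hpT]
    exact hL.hasFDerivAt.comp (h T, m T) hasFDerivAt_fst
  have ha := solvesDampedODE_of_adjoint hp
  -- Unification with `ha` fixes the witnesses: `a` is the momentum component of `p`, and `a'` is `γ
  -- • a` minus its position component.
  refine ⟨fun t ht => ⟨?_, ?_, (hloss ht).differentiableAt⟩, _, _, fun t ht => ?_, ha, ?_, ?_,
    fun t ht => ?_, ha.comp_const_sub⟩
  · obtain ⟨r, hr, _, _, hnear⟩ := (hZ.mono_left ht.1).exists_near ht.2 (hlip ht)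
      (fun z => (hcont z).mono (hsub ht))
    filter_upwards [closedBall_mem_nhds _ hr] with z hz
    obtain ⟨y, hyt, hy, -⟩ := hnear z (mem_closedBall_iff_norm.1 hz)
    exact ⟨fun s => (y s).1, fun s => (y s).2, hy.solvesDampedODE, by simp [hyt], by simp [hyt]⟩
  · intro z x₁ v₁ x₂ v₂ h₁ h₂
    have heq := h₁.solves.solvesODE.eqOn (hlip ht) h₂.solves.solvesODE
      (Prod.ext (h₁.position.trans h₂.position.symm) (h₁.momentum.trans h₂.momentum.symm))
    exact ⟨fun s hs => congrArg Prod.fst (heq hs), fun s hs => congrArg Prod.snd (heq hs)⟩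
  · exact ((hloss ht).comp (m t) (hasFDerivAt_prodMk_right (h t) (m t))).fderiv.symm
  · ext w
    simp [hpT]
  · ext w
    simp [hpT]
  · rw [sub_sub_cancel]
    have hin : HasFDerivAt (fun x : V => (x, m t)) (ContinuousLinearMap.inl ℝ V V) (h t) :=
      hasFDerivAt_prodMk_left (h t) (m t)
    exact (HasFDerivAt.comp (h t) (hloss ht) hin).fderiv
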